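/- Let $\mathbf N_{\ge 2}^\infty$ be the set of sequences $a=(a_1,a_2,\ldots)$ of integers $a_i\ge 2$, a commutative semigroup under the componentwise product $a\cdot b=(a_1b_1,a_2b_2,\ldots)$. For $a\in\mathbf N_{\ge 2}^\infty$ let $\mathcal A(a)$ be the UHF algebra obtained as the C*-inductive limit of the algebras $\mathcal A_n(a)=M_{a_1}(\mathbb C)\otimes\cdots\otimes M_{a_n}(\mathbb C)$ along the embeddings $X\mapsto X\otimes I$. Write $E^{(m)}_{j,k}$ ($1\le j,k\le m$) for the matrix units of $M_m(\mathbb C)$, and let $\otimes$ be the minimal tensor product of C*-algebras. Let $\varphi_{a,b}:\mathcal A(a\cdot b)\to\mathcal A(a)\otimes\mathcal A(b)$ be the unital $*$-isomorphism determined by $$\varphi_{a,b}\bigl(E^{(a_1b_1)}_{j_1,k_1}\otimes\cdots\otimes E^{(a_nb_n)}_{j_n,k_n}\bigr)=\bigl(E^{(a_1)}_{j_1',k_1'}\otimes\cdots\otimes E^{(a_n)}_{j_n',k_n'}\bigr)\otimes\bigl(E^{(b_1)}_{j_1'',k_1''}\otimes\cdots\otimes E^{(b_n)}_{j_n'',k_n''}\bigr),$$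 where $j_i=b_i(j_i'-1)+j_i''$ and $k_i=b_i(k_i'-1)+k_i''$ with $1\le j_i',k_i'\le a_i$ and $1\le j_i'',k_i''\le b_i$. For states $\omega$ of $\mathcal A(a)$ and $\omega'$ of $\mathcal A(b)$ define the state $\omega\otimes_\varphi\omega'=(\omega\otimes\omega')\circ\varphi_{a,b}$ of $\mathcal A(a\cdot b)$. For $*$-representations $\pi$ of $\mathcal A(a)$ and $\pi'$ of $\mathcal A(b)$ define the $*$-representation $\pi\otimes_\varphi\pi'=(\pi\otimes\pi')\circ\varphi_{a,b}$ of $\mathcal A(a\cdot b)$, and on unitary equivalence classes put $[\pi]\otimes_\varphi[\pi']=[\pi\otimes_\varphi\pi']$. For $n\ge2$ and $J=(j_1,j_2,\ldots)\in\{1,\ldots,n\}^\infty$ let $P_n[J]$ be the unitary equivalence class of the GNS representation of $\mathcal A(n,n,\ldots)$ for the product state $\omega_J$ with $$\omega_J\bigl(E^{(n)}_{l_1,k_1}\otimes\cdots\otimes E^{(n)}_{l_m,k_m}\bigr)=\prod_{i=1}^m\delta_{l_i,j_i}\delta_{k_i,j_i}\qquad(m\ge 1),$$ and write $P_n[\mathbf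 j]$ for $P_n[(j,j,j,\ldots)]$. Then $\otimes_\varphi$ is non-symmetric, in the following sense (both sides of each comparison live on $\mathcal A(a\cdot b)=\mathcal A(b\cdot a)$). (i) There exist $a,b\in\mathbf N_{\ge 2}^\infty$ and states $\omega$ of $\mathcal A(a)$ and $\omega'$ of $\mathcal A(b)$ such that $\omega\otimes_\varphi\omega'\ne\omega'\otimes_\varphi\omega$. (ii) There exist $a,b\in\mathbf N_{\ge 2}^\infty$ and unitary equivalence classes $[\pi]$, $[\pi']$ of $*$-representations of $\mathcal A(a)$ and $\mathcal A(b)$, respectively, such that $[\pi]\otimes_\varphi[\pi']\ne[\pi']\otimes_\varphi[\pi]$. For example, $$P_2[\mathbf 1]\otimes_\varphi P_2[\mathbf 2]=P_4[\mathbf 2]\ne P_4[\mathbf 3]=P_2[\mathbf 2]\otimes_\varphi P_2[\mathbf 1].$$ -/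

import Mathlib

open scoped TensorProduct InnerProductSpace
open scoped TensorProduct InnerProductSpace

set_option linter.unusedSectionVars false

noncomputable section

/-! ### Completions of `*`-algebras with respect to a C*-seminorm -/

/-- A C*-seminorm on a complex unital `*`-algebra. -/
structure CStarSeminorm (A : Type*) [Ring A] [StarRing A] [Algebra ℂ A] where
  p : A → ℝ
  nonneg : ∀ x, 0 ≤ p x
  smul_le : ∀ (c : ℂ) x, p (c • x) ≤ ‖c‖ * p x
  add_le : ∀ x y, p (x + y) ≤ p x + p y
  mul_le : ∀ x y, p (x * y) ≤ p x * p y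
  star_le : ∀ x, p (star x) ≤ p x
  cstar : ∀ x, p x * p x ≤ p (star x * x)

namespace CStarSeminorm

open UniformSpace

variable {A : Type*} [Ring A] [StarRing A] [Algebra ℂ A]

/-- The algebra `A` itself, regarded as a seminormed algebra. -/
@[nolint unusedArguments]
def Pre (_p : CStarSeminorm A) : Type _ := A

variable (p : CStarSeminorm A)

theorem p_zero : p.p 0 = 0 := by
  have h := p.smul_le 0 0
  simp only [norm_zero, zero_mul, smul_zero] at h
  exact le_antisymm h (p.nonneg 0)

theorem p_neg (x : A) : p.p (-x) = p.p x := by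
  have h (y : A) : p.p (-y) ≤ p.p y := by
    have := p.smul_le (-1) y
    simpa using this
  exact le_antisymm (h x) (by simpa using h (-x))

/-- `p` as a seminorm on the additive group of `A`. -/
def toAddGroupSeminorm : AddGroupSeminorm A where
  toFun := p.p
  map_zero' := p.p_zero
  add_le' := p.add_le
  neg' := p.p_neg

instance : SeminormedRing p.Pre where
  __ := (inferInstance : Ring A)
  __ := p.toAddGroupSeminorm.toSeminormedAddCommGroup
  norm_mul_le := p.mul_le

instance : StarRing p.Pre := inferInstanceAs (StarRing A)

instance : NormedAlgebra ℂ p.Pre where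
  __ := (inferInstance : Algebra ℂ A)
  norm_smul_le := p.smul_le

/-- The identity map `A → p.Pre`. -/
def toPre : A →⋆ₐ[ℂ] p.Pre := StarAlgHom.id ℂ A

theorem norm_toPre (x : A) : ‖p.toPre x‖ = p.p x := rfl

instance : NormedStarGroup p.Pre where
  norm_star_le := p.star_le

/-- The separated completion of `A` with respect to the C*-seminorm `p`. -/
def Compl : Type _ := Completion p.Pre

instance : NormedRing p.Compl := inferInstanceAs (NormedRing (Completion p.Pre))
instance : CompleteSpace p.Compl := inferInstanceAs (CompleteSpace (Completion p.Pre))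
instance : Algebra ℂ p.Compl := inferInstanceAs (Algebra ℂ (Completion p.Pre))

theorem norm_smul_compl (c : ℂ) (x : Completion p.Pre) : ‖c • x‖ ≤ ‖c‖ * ‖x‖ := norm_smul_le c x

instance : NormedAlgebra ℂ p.Compl where
  norm_smul_le := p.norm_smul_compl

variable [StarModule ℂ A]

instance : StarModule ℂ p.Pre := inferInstanceAs (StarModule ℂ A)

theorem uniformContinuous_star : UniformContinuous (star : p.Pre → p.Pre) :=
  (starₗᵢ ℂ : p.Pre ≃ₗᵢ⋆[ℂ] p.Pre).isometry.uniformContinuous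

/-- The canonical map of `A` into its completion. -/
def of' (x : A) : p.Compl := ((p.toPre x : p.Pre) : Completion p.Pre)

theorem of'_dense : DenseRange p.of' := Completion.denseRange_coe (α := p.Pre)

theorem norm_of' (x : A) : ‖p.of' x‖ = p.p x := Completion.norm_coe (E := p.Pre) _

instance : Star p.Compl := ⟨Completion.map (star : p.Pre → p.Pre)⟩

theorem star_of' (x : A) : star (p.of' x) = p.of' (star x) :=
  Completion.map_coe p.uniformContinuous_star _

theorem continuous_star : Continuous (star : p.Compl → p.Compl) := Completion.continuous_map

theorem of'_mul (x y : A) : p.of' (x * y) = p.of' x * p.of' y := Completion.coe_mul (α := p.Pre) _ _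
theorem of'_add (x y : A) : p.of' (x + y) = p.of' x + p.of' y := Completion.coe_add (α := p.Pre) _ _
theorem of'_smul (c : ℂ) (x : A) : p.of' (c • x) = c • p.of' x :=
  Completion.coe_smul c (p.toPre x)
theorem of'_one : p.of' 1 = 1 := rfl
theorem of'_zero : p.of' 0 = 0 := rfl

/-- Density induction in the completion. -/
theorem induction {P : p.Compl → Prop} (hc : IsClosed {x | P x}) (h : ∀ x, P (p.of' x)) (x) :
    P x :=
  p.of'_dense.induction_on x hc h

theorem induction₂ {P : p.Compl → p.Compl → Prop} (hc : IsClosed {x : p.Compl × p.Compl | P x.1 x.2})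
    (h : ∀ x y, P (p.of' x) (p.of' y)) (x y) : P x y :=
  p.of'_dense.induction_on₂ hc h x y

instance : StarRing p.Compl where
  star_involutive x := by
    induction x using p.induction with
    | hc => exact isClosed_eq (p.continuous_star.comp p.continuous_star) continuous_id
    | h x => rw [star_of', star_of', star_star]
  star_mul x y := by
    induction x, y using p.induction₂ with
    | hc =>
      have := p.continuous_star
      exact isClosed_eq (by fun_prop) (by fun_prop)
    | h x y => rw [← of'_mul, star_of', star_mul, of'_mul, star_of', star_of']
  star_add x y := by
    induction x, y using p.induction₂ with
    | hc =>
      have := p.continuous_star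
      exact isClosed_eq (by fun_prop) (by fun_prop)
    | h x y => rw [← of'_add, star_of', star_add, of'_add, star_of', star_of']

instance : StarModule ℂ p.Compl where
  star_smul c x := by
    induction x using p.induction with
    | hc =>
      exact isClosed_eq (p.continuous_star.comp (continuous_const_smul c))
        (p.continuous_star.const_smul (star c))
    | h x => rw [← of'_smul, star_of', star_smul, of'_smul, star_of']

instance : CStarRing p.Compl where
  norm_mul_self_le x := by
    induction x using p.induction with
    | hc =>
      have := p.continuous_star
      exact isClosed_le (by fun_prop) (by fun_prop)
    | h x => rw [star_of', ← of'_mul, norm_of', norm_of']; exact p.cstar x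

instance : CStarAlgebra p.Compl where

/-- The canonical `*`-homomorphism of `A` into its completion. -/
def of : A →⋆ₐ[ℂ] p.Compl where
  toFun := p.of'
  map_one' := p.of'_one
  map_mul' := p.of'_mul
  map_zero' := p.of'_zero
  map_add' := p.of'_add
  commutes' c := by
    rw [Algebra.algebraMap_eq_smul_one, of'_smul, of'_one, Algebra.algebraMap_eq_smul_one]
  map_star' x := (p.star_of' x).symm

theorem of_dense : DenseRange p.of := p.of'_dense

theorem norm_of (x : A) : ‖p.of x‖ = p.p x := p.norm_of' x

/-- Continuous extension of a linear map which is bounded by the seminorm. -/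
def liftL {E : Type*} [NormedAddCommGroup E] [NormedSpace ℂ E] [CompleteSpace E]
    (f : A →ₗ[ℂ] E) (hf : ∀ x, ‖f x‖ ≤ p.p x) : p.Compl →L[ℂ] E :=
  ContinuousLinearMap.fromCompletion (α := p.Pre)
    (LinearMap.mkContinuous (E := p.Pre) f 1 fun x => by rw [one_mul]; exact hf x)

theorem liftL_of {E : Type*} [NormedAddCommGroup E] [NormedSpace ℂ E] [CompleteSpace E]
    (f : A →ₗ[ℂ] E) (hf : ∀ x, ‖f x‖ ≤ p.p x) (x : A) : p.liftL f hf (p.of x) = f x :=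
  ContinuousLinearMap.fromCompletion_apply_coe (α := p.Pre) _ _

/-- Continuous extension of a `*`-homomorphism into a C*-algebra which is bounded by the
seminorm. -/
def lift {B : Type*} [NonUnitalCStarAlgebra B] (f : A →⋆ₙₐ[ℂ] B) (hf : ∀ x, ‖f x‖ ≤ p.p x) :
    p.Compl →⋆ₙₐ[ℂ] B where
  toFun := p.liftL (f : A →ₗ[ℂ] B) hf
  map_smul' := map_smul _
  map_zero' := map_zero _
  map_add' := map_add _
  map_mul' x y := by
    induction x, y using p.induction₂ with
    | hc => exact isClosed_eq (by fun_prop) (by fun_prop)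
    | h x y =>
      have e (x : A) := p.liftL_of (f : A →ₗ[ℂ] B) hf x
      exact (congrArg _ (p.of'_mul x y).symm).trans ((e (x * y)).trans
        ((map_mul f x y).trans (congrArg₂ (· * ·) (e x) (e y)).symm))
  map_star' x := by
    induction x using p.induction with
    | hc =>
      have := p.continuous_star
      exact isClosed_eq (by fun_prop) (by fun_prop)
    | h x =>
      have e (x : A) := p.liftL_of (f : A →ₗ[ℂ] B) hf x
      exact (congrArg _ (p.star_of' x)).trans ((e (star x)).trans
        ((map_star f x).trans (congrArg star (e x)).symm))

theorem lift_of {B : Type*} [NonUnitalCStarAlgebra B] (f : A →⋆ₙₐ[ℂ] B) (hf : ∀ x, ‖f x‖ ≤ p.p x)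
    (x : A) : p.lift f hf (p.of x) = f x :=
  p.liftL_of _ hf x

/-- Continuous extension of a unital `*`-homomorphism which is bounded by the seminorm. -/
def liftUnital {B : Type*} [CStarAlgebra B] (f : A →⋆ₐ[ℂ] B) (hf : ∀ x, ‖f x‖ ≤ p.p x) :
    p.Compl →⋆ₐ[ℂ] B :=
  have h1 : p.lift (f : A →⋆ₙₐ[ℂ] B) hf 1 = 1 :=
    (p.lift_of (f : A →⋆ₙₐ[ℂ] B) hf 1).trans (map_one f)
  { p.lift (f : A →⋆ₙₐ[ℂ] B) hf with
    map_one' := h1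
    commutes' := fun c => by
      rw [Algebra.algebraMap_eq_smul_one, Algebra.algebraMap_eq_smul_one]
      exact (map_smul (p.lift (f : A →⋆ₙₐ[ℂ] B) hf) c 1).trans (congrArg (c • ·) h1) }

theorem liftUnital_of {B : Type*} [CStarAlgebra B] (f : A →⋆ₐ[ℂ] B) (hf : ∀ x, ‖f x‖ ≤ p.p x)
    (x : A) : p.liftUnital f hf (p.of x) = f x :=
  p.lift_of (f : A →⋆ₙₐ[ℂ] B) hf x

end CStarSeminorm

/-! ### Hilbert space tensor products of bounded operators -/

/-- The Hilbert space tensor product: the completion of the algebraic tensor product for the inner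
product with `⟪x ⊗ y, x' ⊗ y'⟫ = ⟪x, x'⟫ * ⟪y, y'⟫`. -/
def HilbertTensor (H K : Type) [NormedAddCommGroup H] [InnerProductSpace ℂ H]
    [NormedAddCommGroup K] [InnerProductSpace ℂ K] : Type :=
  UniformSpace.Completion (H ⊗[ℂ] K)

section HilbertTensor

open UniformSpace

variable {H K H' K' : Type} [NormedAddCommGroup H] [InnerProductSpace ℂ H]
  [NormedAddCommGroup K] [InnerProductSpace ℂ K]
  [NormedAddCommGroup H'] [InnerProductSpace ℂ H']
  [NormedAddCommGroup K'] [InnerProductSpace ℂ K']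

instance : NormedAddCommGroup (HilbertTensor H K) :=
  inferInstanceAs (NormedAddCommGroup (Completion (H ⊗[ℂ] K)))
instance : InnerProductSpace ℂ (HilbertTensor H K) :=
  inferInstanceAs (InnerProductSpace ℂ (Completion (H ⊗[ℂ] K)))
instance : CompleteSpace (HilbertTensor H K) :=
  inferInstanceAs (CompleteSpace (Completion (H ⊗[ℂ] K)))

variable (H K) in
/-- The isometric embedding of the algebraic tensor product. -/
def HilbertTensor.of : H ⊗[ℂ] K →ₗᵢ[ℂ] HilbertTensor H K :=
  Completion.toComplₗᵢ (𝕜 := ℂ) (E := H ⊗[ℂ] K)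

theorem HilbertTensor.of_dense : DenseRange (HilbertTensor.of H K) :=
  Completion.denseRange_coe (α := H ⊗[ℂ] K)

/-- The elementary tensor `x ⊗ y` in the Hilbert space tensor product. -/
def htmul (x : H) (y : K) : HilbertTensor H K := HilbertTensor.of H K (x ⊗ₜ[ℂ] y)

/-- The bounded operator `S ⊗ T` on the Hilbert space tensor product. -/
def opTensor (S : H →L[ℂ] H') (T : K →L[ℂ] K') : HilbertTensor H K →L[ℂ] HilbertTensor H' K' :=
  (TensorProduct.mapL S T).completion

theorem opTensor_coe (S : H →L[ℂ] H') (T : K →L[ℂ] K') (x : H ⊗[ℂ] K) :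
    opTensor S T (HilbertTensor.of H K x) = HilbertTensor.of H' K' (TensorProduct.mapL S T x) :=
  ContinuousLinearMap.completion_apply_coe _ _

theorem opTensor_htmul (S : H →L[ℂ] H') (T : K →L[ℂ] K') (x : H) (y : K) :
    opTensor S T (htmul x y) = htmul (S x) (T y) := opTensor_coe _ _ _

theorem op_ext {E : Type*} [NormedAddCommGroup E] [NormedSpace ℂ E]
    {S T : HilbertTensor H K →L[ℂ] E} (h : ∀ x y, S (htmul x y) = T (htmul x y)) : S = T := by
  ext z
  induction z using HilbertTensor.of_dense.induction_on with
  | hp => exact isClosed_eq S.continuous T.continuous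
  | ih z =>
    induction z with
    | zero => simp
    | add a b ha hb => rw [map_add, map_add, map_add, ha, hb]
    | tmul x y => exact h x y

theorem inner_htmul (x x' : H) (y y' : K) :
    ⟪htmul x y, htmul x' y'⟫_ℂ = ⟪x, x'⟫_ℂ * ⟪y, y'⟫_ℂ := by
  rw [htmul, htmul, LinearIsometry.inner_map_map, TensorProduct.inner_tmul]

theorem opTensor_mul (S S' : H →L[ℂ] H) (T T' : K →L[ℂ] K) :
    opTensor (S * S') (T * T') = opTensor S T * opTensor S' T' :=
  op_ext fun x y => by simp [opTensor_htmul]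

theorem opTensor_add_left (S S' : H →L[ℂ] H) (T : K →L[ℂ] K) :
    opTensor (S + S') T = opTensor S T + opTensor S' T :=
  op_ext fun x y => by
    simp only [add_apply, opTensor_htmul]
    rw [htmul, TensorProduct.add_tmul, map_add]; rfl

theorem opTensor_add_right (S : H →L[ℂ] H) (T T' : K →L[ℂ] K) :
    opTensor S (T + T') = opTensor S T + opTensor S T' :=
  op_ext fun x y => by
    simp only [add_apply, opTensor_htmul]
    rw [htmul, TensorProduct.tmul_add, map_add]; rfl

theorem opTensor_smul_left (c : ℂ) (S : H →L[ℂ] H) (T : K →L[ℂ] K) :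
    opTensor (c • S) T = c • opTensor S T :=
  op_ext fun x y => by
    simp only [smul_apply, opTensor_htmul]
    rw [htmul, ← TensorProduct.smul_tmul', map_smul]; rfl

theorem opTensor_smul_right (c : ℂ) (S : H →L[ℂ] H) (T : K →L[ℂ] K) :
    opTensor S (c • T) = c • opTensor S T :=
  op_ext fun x y => by
    simp only [smul_apply, opTensor_htmul]
    rw [htmul, TensorProduct.tmul_smul, map_smul]; rfl

theorem opTensor_star [CompleteSpace H] [CompleteSpace K] (S : H →L[ℂ] H) (T : K →L[ℂ] K) :
    opTensor (star S) (star T) = star (opTensor S T) := by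
  rw [ContinuousLinearMap.star_eq_adjoint (opTensor S T), ContinuousLinearMap.eq_adjoint_iff]
  intro x y
  induction x, y using HilbertTensor.of_dense.induction_on₂ with
  | hp => exact isClosed_eq (by fun_prop) (by fun_prop)
  | h x y =>
    rw [opTensor_coe, opTensor_coe, LinearIsometry.inner_map_map, LinearIsometry.inner_map_map]
    induction x with
    | zero => simp
    | add a b ha hb => rw [map_add, inner_add_left, inner_add_left, ha, hb]
    | tmul a b =>
      induction y with
      | zero => simp
      | add c d hc hd => rw [map_add, inner_add_right, inner_add_right, hc, hd]
      | tmul c d =>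
        simp [ContinuousLinearMap.star_eq_adjoint,
          ContinuousLinearMap.adjoint_inner_left]

end HilbertTensor

/-! ### Representations and the minimal tensor product -/

/-- A `*`-representation of a C*-algebra on a complex Hilbert space. -/
structure StarRep (A : Type) [CStarAlgebra A] : Type 1 where
  H : Type
  [instNACG : NormedAddCommGroup H]
  [instIPS : InnerProductSpace ℂ H]
  [instCS : CompleteSpace H]
  π : A →⋆ₙₐ[ℂ] (H →L[ℂ] H)

attribute [instance] StarRep.instNACG StarRep.instIPS StarRep.instCS

section MinTensor

variable {A B : Type} [CStarAlgebra A] [CStarAlgebra B]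

theorem StarRep.norm_le (π : StarRep A) (a : A) : ‖π.π a‖ ≤ ‖a‖ := NonUnitalStarAlgHom.norm_apply_le π.π a

/-- The linear map `a ⊗ b ↦ π(a) ⊗ σ(b)` on the algebraic tensor product. -/
def StarRep.algTensorL (π : StarRep A) (σ : StarRep B) :
    A ⊗[ℂ] B →ₗ[ℂ] (HilbertTensor π.H σ.H →L[ℂ] HilbertTensor π.H σ.H) :=
  TensorProduct.lift (LinearMap.mk₂ ℂ (fun a b => opTensor (π.π a) (σ.π b))
    (fun a a' b => by rw [map_add, opTensor_add_left])
    (fun c a b => by rw [map_smul, opTensor_smul_left])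
    (fun a b b' => by rw [map_add, opTensor_add_right])
    (fun c a b => by rw [map_smul, opTensor_smul_right]))

theorem StarRep.algTensorL_tmul (π : StarRep A) (σ : StarRep B) (a : A) (b : B) :
    π.algTensorL σ (a ⊗ₜ b) = opTensor (π.π a) (σ.π b) := rfl

/-- The `*`-homomorphism `a ⊗ b ↦ π(a) ⊗ σ(b)` on the algebraic tensor product. -/
def StarRep.algTensor (π : StarRep A) (σ : StarRep B) :
    A ⊗[ℂ] B →⋆ₙₐ[ℂ] (HilbertTensor π.H σ.H →L[ℂ] HilbertTensor π.H σ.H) where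
  toFun := π.algTensorL σ
  map_smul' := map_smul _
  map_zero' := map_zero _
  map_add' := map_add _
  map_mul' x y := by
    induction x with
    | zero => rw [zero_mul, map_zero, zero_mul]
    | add x x' h h' => rw [add_mul, map_add, map_add, add_mul, h, h']
    | tmul a b =>
      induction y with
      | zero => rw [mul_zero, map_zero, mul_zero]
      | add y y' h h' => rw [mul_add, map_add, map_add, mul_add, h, h']
      | tmul c d =>
        rw [Algebra.TensorProduct.tmul_mul_tmul, algTensorL_tmul, algTensorL_tmul, algTensorL_tmul,
          map_mul, map_mul, opTensor_mul]
  map_star' x := by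
    induction x with
    | zero => rw [star_zero, map_zero, star_zero]
    | add x x' h h' => rw [star_add, map_add, map_add, star_add, h, h']
    | tmul a b =>
      rw [TensorProduct.star_tmul, algTensorL_tmul, algTensorL_tmul, map_star, map_star,
        opTensor_star]

theorem StarRep.algTensor_tmul (π : StarRep A) (σ : StarRep B) (a : A) (b : B) :
    π.algTensor σ (a ⊗ₜ b) = opTensor (π.π a) (σ.π b) := rfl

theorem norm_opTensor_le {H K : Type} [NormedAddCommGroup H] [InnerProductSpace ℂ H]
    [NormedAddCommGroup K] [InnerProductSpace ℂ K] (S : H →L[ℂ] H) (T : K →L[ℂ] K) :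
    ‖opTensor S T‖ ≤ ‖S‖ * ‖T‖ := by
  refine ContinuousLinearMap.opNorm_le_bound _ (by positivity) fun z => ?_
  induction z using HilbertTensor.of_dense.induction_on with
  | hp => exact isClosed_le (by fun_prop) (by fun_prop)
  | ih z =>
    rw [opTensor_coe, LinearIsometry.norm_map, LinearIsometry.norm_map]
    exact (ContinuousLinearMap.le_opNorm _ _).trans
      (mul_le_mul_of_nonneg_right (TensorProduct.norm_mapL_le S T) (norm_nonneg _))

/-- The minimal (spatial) C*-seminorm `‖x‖ = sup ‖(π ⊗ σ)(x)‖` on the algebraic tensor product, the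
supremum being taken over all pairs of representations. -/
def minNorm (x : A ⊗[ℂ] B) : ℝ := ⨆ p : StarRep A × StarRep B, ‖p.1.algTensor p.2 x‖

theorem minNorm_bdd (x : A ⊗[ℂ] B) :
    BddAbove (Set.range fun p : StarRep A × StarRep B => ‖p.1.algTensor p.2 x‖) := by
  induction x with
  | zero => exact ⟨0, by rintro _ ⟨p, rfl⟩; simp⟩
  | tmul a b =>
    refine ⟨‖a‖ * ‖b‖, ?_⟩
    rintro _ ⟨p, rfl⟩
    exact (norm_opTensor_le _ _).trans
      (mul_le_mul (p.1.norm_le a) (p.2.norm_le b) (norm_nonneg _) (norm_nonneg _))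
  | add x y hx hy =>
    obtain ⟨c, hc⟩ := hx
    obtain ⟨d, hd⟩ := hy
    refine ⟨c + d, ?_⟩
    rintro _ ⟨p, rfl⟩
    beta_reduce
    rw [map_add]
    exact (norm_add_le _ _).trans (add_le_add (hc ⟨p, rfl⟩) (hd ⟨p, rfl⟩))

theorem le_minNorm (π : StarRep A) (σ : StarRep B) (x : A ⊗[ℂ] B) : ‖π.algTensor σ x‖ ≤ minNorm x :=
  le_ciSup (minNorm_bdd x) (π, σ)

theorem minNorm_nonneg (x : A ⊗[ℂ] B) : 0 ≤ minNorm x := Real.iSup_nonneg fun _ => norm_nonneg _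

variable (A B) in
/-- The minimal norm as a C*-seminorm. -/
def minSeminorm : CStarSeminorm (A ⊗[ℂ] B) where
  p := minNorm
  nonneg := minNorm_nonneg
  smul_le c x := Real.iSup_le (fun p => by
    rw [map_smul, norm_smul]
    exact mul_le_mul_of_nonneg_left (le_minNorm _ _ _) (norm_nonneg _))
    (mul_nonneg (norm_nonneg _) (minNorm_nonneg _))
  add_le x y := Real.iSup_le (fun p => by
    rw [map_add]
    exact (norm_add_le _ _).trans (add_le_add (le_minNorm _ _ _) (le_minNorm _ _ _)))
    (add_nonneg (minNorm_nonneg _) (minNorm_nonneg _))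
  mul_le x y := Real.iSup_le (fun p => by
    rw [map_mul]
    exact (norm_mul_le _ _).trans
      (mul_le_mul (le_minNorm _ _ _) (le_minNorm _ _ _) (norm_nonneg _) (minNorm_nonneg _)))
    (mul_nonneg (minNorm_nonneg _) (minNorm_nonneg _))
  star_le x := Real.iSup_le (fun p => by
    rw [map_star, norm_star]
    exact le_minNorm _ _ _) (minNorm_nonneg _)
  cstar x := by
    have h : minNorm x ≤ √(minNorm (star x * x)) := Real.iSup_le (fun p => by
      refine Real.le_sqrt_of_sq_le ?_
      rw [sq, ← CStarRing.norm_star_mul_self, ← map_star, ← map_mul]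
      exact le_minNorm _ _ _) (Real.sqrt_nonneg _)
    exact (mul_self_le_mul_self (minNorm_nonneg x) h).trans
      (Real.mul_self_sqrt (minNorm_nonneg _)).le

variable (A B) in
/-- The minimal C*-tensor product. -/
def MinTensor : Type := (minSeminorm A B).Compl

instance : CStarAlgebra (MinTensor A B) := inferInstanceAs (CStarAlgebra (minSeminorm A B).Compl)

variable (A B) in
/-- The canonical `*`-homomorphism of the algebraic into the minimal tensor product. -/
def MinTensor.of : A ⊗[ℂ] B →⋆ₐ[ℂ] MinTensor A B := (minSeminorm A B).of

/-- The `*`-homomorphism `π ⊗ σ` on the minimal tensor product, which maps `a ⊗ b` to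
`π(a) ⊗ σ(b)`. -/
def StarRep.tensorHom (π : StarRep A) (σ : StarRep B) :
    MinTensor A B →⋆ₙₐ[ℂ] (HilbertTensor π.H σ.H →L[ℂ] HilbertTensor π.H σ.H) :=
  (minSeminorm A B).lift (π.algTensor σ) (le_minNorm π σ)

theorem StarRep.tensorHom_of (π : StarRep A) (σ : StarRep B) (x : A ⊗[ℂ] B) :
    π.tensorHom σ (MinTensor.of A B x) = π.algTensor σ x :=
  (minSeminorm A B).lift_of _ _ _

theorem StarRep.tensorHom_tmul (π : StarRep A) (σ : StarRep B) (a : A) (b : B) :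
    π.tensorHom σ (MinTensor.of A B (a ⊗ₜ b)) = opTensor (π.π a) (σ.π b) :=
  π.tensorHom_of σ _

theorem StarRep.tensorHom_continuous (π : StarRep A) (σ : StarRep B) :
    Continuous (π.tensorHom σ) :=
  AddMonoidHomClass.continuous_of_bound (π.tensorHom σ) 1 fun x => by
    rw [one_mul]; exact NonUnitalStarAlgHom.norm_apply_le _ x

/-- The representation `π ⊗ σ` of the minimal tensor product. -/
def StarRep.tensor (π : StarRep A) (σ : StarRep B) : StarRep (MinTensor A B) where
  H := HilbertTensor π.H σ.H
  π := π.tensorHom σ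

theorem MinTensor.of_dense : DenseRange (MinTensor.of A B) := (minSeminorm A B).of_dense

end MinTensor

/-! ### Unitary equivalence -/

section UnitaryEquivalence

variable {A B : Type} [CStarAlgebra A] [CStarAlgebra B]

/-- Unitary equivalence of representations. -/
def StarRep.Equivalent (π σ : StarRep A) : Prop :=
  ∃ U : π.H ≃ₗᵢ[ℂ] σ.H, ∀ a x, U (π.π a x) = σ.π a (U x)

variable (A) in
/-- The setoid of unitary equivalence. -/
def StarRep.setoid : Setoid (StarRep A) where
  r := StarRep.Equivalent
  iseqv :=
    { refl := fun π => ⟨.refl ℂ _, fun _ _ => rfl⟩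
      symm := fun ⟨U, h⟩ => ⟨U.symm, fun a x => by
        rw [LinearIsometryEquiv.symm_apply_eq, h, U.apply_symm_apply]⟩
      trans := fun ⟨U, h⟩ ⟨V, k⟩ => ⟨U.trans V, fun a x => by
        simp only [LinearIsometryEquiv.trans_apply, h, k]⟩ }

variable (A) in
/-- The unitary equivalence classes of representations. -/
def RepClass : Type 1 := Quotient (StarRep.setoid A)

/-- The unitary equivalence class of a representation. -/
def StarRep.cls (π : StarRep A) : RepClass A := Quotient.mk (StarRep.setoid A) π

/-- The pull-back of a representation along a `*`-homomorphism. -/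
def StarRep.comp (π : StarRep B) (f : A →⋆ₐ[ℂ] B) : StarRep A where
  H := π.H
  π := π.π.comp (f : A →⋆ₙₐ[ℂ] B)

theorem StarRep.Equivalent.comp {π σ : StarRep B} (h : π.Equivalent σ) (f : A →⋆ₐ[ℂ] B) :
    (π.comp f).Equivalent (σ.comp f) := by
  obtain ⟨U, hU⟩ := h
  exact ⟨U, fun a x => hU (f a) x⟩

theorem StarRep.Equivalent.tensor {π π' : StarRep A} {σ σ' : StarRep B} (h : π.Equivalent π')
    (k : σ.Equivalent σ') : (π.tensor σ).Equivalent (π'.tensor σ') := by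
  obtain ⟨U, hU⟩ := h
  obtain ⟨V, hV⟩ := k
  let W : HilbertTensor π.H σ.H →L[ℂ] HilbertTensor π'.H σ'.H :=
    opTensor U.toContinuousLinearEquiv.toContinuousLinearMap
      V.toContinuousLinearEquiv.toContinuousLinearMap
  let W' : HilbertTensor π'.H σ'.H →L[ℂ] HilbertTensor π.H σ.H :=
    opTensor U.symm.toContinuousLinearEquiv.toContinuousLinearMap
      V.symm.toContinuousLinearEquiv.toContinuousLinearMap
  have hW (x y) : W (htmul x y) = htmul (U x) (V y) := opTensor_htmul _ _ _ _
  have hW' (x y) : W' (htmul x y) = htmul (U.symm x) (V.symm y) := opTensor_htmul _ _ _ _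
  have h1 : W'.comp W = .id ℂ _ := op_ext fun x y => by
    simp [hW, hW']
  have h2 : W.comp W' = .id ℂ _ := op_ext fun x y => by
    simp [hW, hW']
  have hn (z) : ‖W z‖ = ‖z‖ := by
    induction z using HilbertTensor.of_dense.induction_on with
    | hp => exact isClosed_eq (by fun_prop) (by fun_prop)
    | ih z =>
      rw [opTensor_coe, LinearIsometry.norm_map, LinearIsometry.norm_map]
      rw [TensorProduct.mapL_apply]
      exact TensorProduct.norm_map U.toLinearIsometry V.toLinearIsometry z
  let E : HilbertTensor π.H σ.H ≃ₗᵢ[ℂ] HilbertTensor π'.H σ'.H :=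
    { toLinearEquiv := LinearEquiv.ofLinearMap W.toLinearMap W'.toLinearMap
        (by ext z; exact congrArg (fun T => T z) h2) (by ext z; exact congrArg (fun T => T z) h1)
      norm_map' := hn }
  refine ⟨E, fun a x => ?_⟩
  suffices h : W.comp (π.tensorHom σ a) = (π'.tensorHom σ' a).comp W from
    congrArg (fun T => T x) h
  induction a using MinTensor.of_dense.induction_on with
  | hp =>
    exact isClosed_eq (continuous_const.clm_comp (π.tensorHom_continuous σ))
      ((π'.tensorHom_continuous σ').clm_comp continuous_const)
  | ih t =>
    rw [tensorHom_of, tensorHom_of]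
    induction t with
    | zero => simp
    | add t t' h h' =>
      rw [map_add, map_add, ContinuousLinearMap.comp_add, h, h', ContinuousLinearMap.add_comp]
    | tmul a b =>
      refine op_ext fun x y => ?_
      rw [algTensor_tmul, algTensor_tmul, ContinuousLinearMap.comp_apply,
        ContinuousLinearMap.comp_apply, opTensor_htmul, hW, hW, opTensor_htmul, hU, hV]

/-- The tensor product of unitary equivalence classes. -/
def RepClass.tensor (x : RepClass A) (y : RepClass B) : RepClass (MinTensor A B) :=
  Quotient.map₂ StarRep.tensor (fun _ _ h _ _ k => StarRep.Equivalent.tensor h k) x y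

/-- The pull-back of unitary equivalence classes. -/
def RepClass.comp (x : RepClass B) (f : A →⋆ₐ[ℂ] B) : RepClass A :=
  Quotient.map (fun π => StarRep.comp π f) (fun _ _ h => StarRep.Equivalent.comp h f) x

end UnitaryEquivalence

/-! ### States -/

section States

open scoped ComplexOrder

/-- A state of a unital C*-algebra: a positive linear functional with value `1` at the unit. -/
structure CStarState (A : Type) [CStarAlgebra A] where
  toLin : A →ₗ[ℂ] ℂ
  nonneg : ∀ x, 0 ≤ toLin (star x * x)
  map_one : toLin 1 = 1

variable {A B : Type} [CStarAlgebra A] [CStarAlgebra B]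

@[ext]
theorem CStarState.ext {ω ω' : CStarState A} (h : ∀ x, ω.toLin x = ω'.toLin x) : ω = ω' := by
  obtain ⟨f, _, _⟩ := ω
  obtain ⟨g, _, _⟩ := ω'
  obtain rfl : f = g := LinearMap.ext h
  rfl

/-- A state as a positive linear map, for the order on `A` in which the positive elements are those
of the form `x* x`. -/
def CStarState.toPositive (ω : CStarState A) :
    letI := CStarAlgebra.spectralOrder A
    A →ₚ[ℂ] ℂ :=
  letI := CStarAlgebra.spectralOrder A
  haveI := CStarAlgebra.spectralOrderedRing A
  PositiveLinearMap.mk₀ ω.toLin fun x hx => by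
    obtain ⟨y, rfl⟩ := CStarAlgebra.nonneg_iff_eq_star_mul_self.mp hx
    exact ω.nonneg y

/-- The GNS representation of a state. -/
def CStarState.gns (ω : CStarState A) : StarRep A :=
  letI := CStarAlgebra.spectralOrder A
  haveI := CStarAlgebra.spectralOrderedRing A
  { H := ω.toPositive.GNS
    π := ω.toPositive.gnsNonUnitalStarAlgHom }

/-- The cyclic vector of the GNS representation. -/
def CStarState.gnsVec (ω : CStarState A) : ω.gns.H :=
  letI := CStarAlgebra.spectralOrder A
  haveI := CStarAlgebra.spectralOrderedRing A
  ((ω.toPositive.toPreGNS 1 : ω.toPositive.PreGNS) : ω.toPositive.GNS)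

theorem CStarState.inner_gnsVec (ω : CStarState A) (a : A) :
    ⟪ω.gnsVec, ω.gns.π a ω.gnsVec⟫_ℂ = ω.toLin a := by
  let _ := CStarAlgebra.spectralOrder A
  have _ := CStarAlgebra.spectralOrderedRing A
  have h1 : ω.gns.π a ω.gnsVec = ((ω.toPositive.toPreGNS a : ω.toPositive.PreGNS) :
      ω.toPositive.GNS) := by
    refine (PositiveLinearMap.gnsNonUnitalStarAlgHom_apply_coe ω.toPositive).trans ?_
    simp
  rw [h1]
  refine (UniformSpace.Completion.inner_coe _ _).trans ?_
  rw [PositiveLinearMap.preGNS_inner_def]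
  change ω.toLin (star 1 * a) = ω.toLin a
  rw [star_one, one_mul]

/-- The state `a ↦ ⟪Ω, π(a) Ω⟫`. -/
def CStarState.ofVector {H : Type} [NormedAddCommGroup H] [InnerProductSpace ℂ H] [CompleteSpace H]
    (π : A →⋆ₙₐ[ℂ] (H →L[ℂ] H)) (Ω : H) (h : ⟪Ω, π 1 Ω⟫_ℂ = 1) : CStarState A where
  toLin :=
    { toFun := fun a => ⟪Ω, π a Ω⟫_ℂ
      map_add' := fun a b => by rw [map_add, add_apply, inner_add_right]
      map_smul' := fun c a => by
        rw [map_smul, smul_apply, inner_smul_right]; rfl }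
  nonneg x := by
    change 0 ≤ ⟪Ω, π (star x * x) Ω⟫_ℂ
    rw [map_mul, map_star, mul_apply_eq_comp, ContinuousLinearMap.star_eq_adjoint,
      ContinuousLinearMap.adjoint_inner_right]
    rw [inner_self_eq_norm_sq_to_K]
    simp
  map_one := h

theorem CStarState.tensor_aux (ω : CStarState A) (ω' : CStarState B) (a : A) (b : B) :
    ⟪htmul ω.gnsVec ω'.gnsVec,
      ω.gns.tensorHom ω'.gns (MinTensor.of A B (a ⊗ₜ b)) (htmul ω.gnsVec ω'.gnsVec)⟫_ℂ
      = ω.toLin a * ω'.toLin b := by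
  rw [StarRep.tensorHom_tmul, opTensor_htmul, inner_htmul, inner_gnsVec, inner_gnsVec]

/-- The product state `ω ⊗ ω'` on the minimal tensor product, that is, the unique state with
`(ω ⊗ ω') (a ⊗ b) = ω a * ω' b`; it is the vector state of the tensor product of the two GNS
vectors. -/
def CStarState.tensor (ω : CStarState A) (ω' : CStarState B) : CStarState (MinTensor A B) :=
  .ofVector (ω.gns.tensorHom ω'.gns) (htmul ω.gnsVec ω'.gnsVec) <| by
    have h := ω.tensor_aux ω' 1 1
    rwa [← Algebra.TensorProduct.one_def, _root_.map_one, ω.map_one, ω'.map_one, mul_one] at h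

theorem CStarState.tensor_tmul (ω : CStarState A) (ω' : CStarState B) (a : A) (b : B) :
    (ω.tensor ω').toLin (MinTensor.of A B (a ⊗ₜ b)) = ω.toLin a * ω'.toLin b :=
  ω.tensor_aux ω' a b

/-- The pull-back of a state along a unital `*`-homomorphism. -/
def CStarState.comp (ω : CStarState B) (f : A →⋆ₐ[ℂ] B) : CStarState A where
  toLin := ω.toLin ∘ₗ (f : A →ₗ[ℂ] B)
  nonneg x := by
    change 0 ≤ ω.toLin (f (star x * x))
    rw [map_mul, map_star]
    exact ω.nonneg _
  map_one := by
    change ω.toLin (f 1) = 1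
    rw [_root_.map_one, ω.map_one]

end States

/-! ### UHF algebras -/

/-- The set `{2, 3, 4, …}`. -/
@[ext]
structure NGeTwo where
  val : ℕ
  two_le : 2 ≤ val

instance : CommSemigroup NGeTwo where
  mul m n := ⟨m.val * n.val, le_trans m.two_le (Nat.le_mul_of_pos_right _ (by have := n.two_le; omega))⟩
  mul_assoc a b c := NGeTwo.ext (mul_assoc a.val b.val c.val)
  mul_comm a b := NGeTwo.ext (mul_comm a.val b.val)

/-- The sequences in `{2, 3, 4, …}`, with the pointwise product. -/
abbrev SeqGeTwo : Type := ℕ → NGeTwo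

/-- The multi-indices `(j₁, …, jₙ)` with `jᵢ` in a set of `aᵢ` elements; all indices start at `0`
here. -/
abbrev MultiIndex (a : SeqGeTwo) (n : ℕ) : Type := ∀ i : Fin n, Fin (a i).val

/-- The remaining components, with numbers `n, …, m - 1`, of a multi-index of length `m`. -/
abbrev TailIndex (a : SeqGeTwo) (n m : ℕ) : Type := ∀ i : {i : Fin m // n ≤ i.1}, Fin (a i.1).val

/-- The tensor product `M_{a₁} ⊗ ⋯ ⊗ M_{aₙ}` as a matrix algebra: the matrix unit `E_{J,K}` stands
for `E_{j₁,k₁} ⊗ ⋯ ⊗ E_{jₙ,kₙ}`. -/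
abbrev MatAlg (a : SeqGeTwo) (n : ℕ) : Type := Matrix (MultiIndex a n) (MultiIndex a n) ℂ

/-- The initial part of a multi-index. -/
def MultiIndex.res {a : SeqGeTwo} {n m : ℕ} (h : n ≤ m) (J : MultiIndex a m) : MultiIndex a n :=
  fun i => J (Fin.castLE h i)

/-- The splitting of a multi-index of length `m` into the first `n` components and the others. -/
def MultiIndex.split (a : SeqGeTwo) {n m : ℕ} (h : n ≤ m) :
    MultiIndex a m ≃ MultiIndex a n × TailIndex a n m where
  toFun J := (J.res h, fun i => J i.1)
  invFun p i := if hi : i.1 < n then p.1 ⟨i.1, hi⟩ else p.2 ⟨i, not_lt.mp hi⟩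
  left_inv J := by
    funext i
    by_cases hi : i.1 < n
    · simp only [hi, dite_true]; rfl
    · simp only [hi, dite_false]
  right_inv p := by
    refine Prod.ext (funext fun i => ?_) (funext fun i => ?_)
    · have hi : (Fin.castLE h i).1 < n := i.2
      simp only [MultiIndex.res, hi, dite_true]; rfl
    · have hi : ¬ i.1.1 < n := not_lt.mpr i.2
      simp only [hi, dite_false]

section UHF

open scoped Matrix.Norms.L2Operator Kronecker

/-- The embedding `X ↦ X ⊗ I` of `M_{a₁} ⊗ ⋯ ⊗ M_{aₙ}` into `M_{a₁} ⊗ ⋯ ⊗ M_{aₘ}`, `n ≤ m`. -/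
def MatAlg.emb (a : SeqGeTwo) {n m : ℕ} (h : n ≤ m) : MatAlg a n →⋆ₐ[ℂ] MatAlg a m where
  toFun X := (X ⊗ₖ (1 : Matrix (TailIndex a n m) (TailIndex a n m) ℂ)).submatrix
    (MultiIndex.split a h) (MultiIndex.split a h)
  map_one' := by rw [Matrix.one_kronecker_one, Matrix.submatrix_one_equiv]
  map_mul' X Y := by
    rw [Matrix.submatrix_mul_equiv, ← Matrix.mul_kronecker_mul, one_mul]
  map_zero' := by rw [Matrix.zero_kronecker]; rfl
  map_add' X Y := by rw [Matrix.add_kronecker]; rfl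
  commutes' c := by
    rw [Algebra.algebraMap_eq_smul_one, Matrix.smul_kronecker, Matrix.one_kronecker_one,
      Algebra.algebraMap_eq_smul_one,
      ← Matrix.submatrix_one_equiv (α := ℂ) (MultiIndex.split a h)]
    rfl
  map_star' X := by
    rw [Matrix.star_eq_conjTranspose, Matrix.star_eq_conjTranspose, Matrix.conjTranspose_submatrix,
      Matrix.conjTranspose_kronecker, Matrix.conjTranspose_one]

theorem MatAlg.emb_apply (a : SeqGeTwo) {n m : ℕ} (h : n ≤ m) (X : MatAlg a n)
    (J K : MultiIndex a m) :
    MatAlg.emb a h X J K =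
      X (J.res h) (K.res h) * if ∀ i : Fin m, n ≤ i.1 → J i = K i then 1 else 0 := by
  change X (J.res h) (K.res h) * (1 : Matrix (TailIndex a n m) (TailIndex a n m) ℂ) _ _ = _
  rw [Matrix.one_apply]
  congr 1
  refine if_congr ?_ rfl rfl
  constructor
  · exact fun e i hi => congrFun e ⟨i, hi⟩
  · exact fun e => funext fun i => e i.1 i.2

instance (a : SeqGeTwo) : DirectedSystem (MatAlg a) (fun _ _ h => MatAlg.emb a h) where
  map_self n X := by
    ext J K
    rw [MatAlg.emb_apply, if_pos (fun i hi => absurd hi (not_le.mpr i.2)), mul_one]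
    rfl
  map_map k m n h h' X := by
    ext J K
    rw [MatAlg.emb_apply, MatAlg.emb_apply, MatAlg.emb_apply, mul_assoc]
    congr 1
    have e : (∀ i : Fin k, n ≤ i.1 → J i = K i) ↔
        (∀ i : Fin m, n ≤ i.1 → J.res h' i = K.res h' i) ∧ ∀ i : Fin k, m ≤ i.1 → J i = K i := by
      refine ⟨fun H => ⟨fun i hi => H (Fin.castLE h' i) hi, fun i hi => H i (h.trans hi)⟩,
        fun H i hi => ?_⟩
      by_cases him : i.1 < m
      · exact H.1 ⟨i.1, him⟩ hi
      · exact H.2 i (not_lt.mp him)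
    by_cases h1 : ∀ i : Fin m, n ≤ i.1 → J.res h' i = K.res h' i
    · by_cases h2 : ∀ i : Fin k, m ≤ i.1 → J i = K i
      · rw [if_pos h1, if_pos h2, if_pos (e.2 ⟨h1, h2⟩), mul_one]
      · rw [if_neg h2, if_neg (fun H => h2 (e.1 H).2), mul_zero]
    · rw [if_neg h1, if_neg (fun H => h1 (e.1 H).1), zero_mul]

theorem MatAlg.emb_injective (a : SeqGeTwo) {n m : ℕ} (h : n ≤ m) :
    Function.Injective (MatAlg.emb a h) := by
  intro X Y e
  ext J K
  let t : TailIndex a n m := fun i => ⟨0, lt_of_lt_of_le two_pos (a i.1).two_le⟩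
  have := congrFun (congrFun e ((MultiIndex.split a h).symm (J, t)))
    ((MultiIndex.split a h).symm (K, t))
  simpa [MatAlg.emb] using this

theorem MatAlg.norm_emb (a : SeqGeTwo) {n m : ℕ} (h : n ≤ m) (X : MatAlg a n) :
    ‖MatAlg.emb a h X‖ = ‖X‖ :=
  NonUnitalStarAlgHom.norm_map (MatAlg.emb a h) (MatAlg.emb_injective a h) X

/-- The algebraic inductive limit of the algebras `M_{a₁} ⊗ ⋯ ⊗ M_{aₙ}`. -/
abbrev UHFAlg (a : SeqGeTwo) : Type := DirectLimit (MatAlg a) (fun _ _ h => MatAlg.emb a h)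

namespace UHFAlg

variable (a : SeqGeTwo)

instance : StarModule ℂ (UHFAlg a) := inferInstance

/-- The C*-norm on the algebraic inductive limit, which extends the operator norms of the matrix
algebras. -/
def norm : CStarSeminorm (UHFAlg a) where
  p := DirectLimit.lift _ (fun _ X => ‖X‖) (fun _ _ h X => (MatAlg.norm_emb a h X).symm)
  nonneg := DirectLimit.induction _ fun n X => norm_nonneg X
  smul_le c := DirectLimit.induction _ fun n X => (norm_smul_le c X)
  add_le := DirectLimit.induction₂ _ fun n X Y => by
    rw [DirectLimit.add_def]; exact norm_add_le X Y
  mul_le := DirectLimit.induction₂ _ fun n X Y => by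
    rw [DirectLimit.mul_def]; exact norm_mul_le X Y
  star_le := DirectLimit.induction _ fun n X => (norm_star X).le
  cstar := DirectLimit.induction _ fun n X => by
    rw [DirectLimit.star_def, DirectLimit.mul_def]
    exact CStarRing.norm_star_mul_self.ge

/-- The canonical map of the `n`-th matrix algebra into the algebraic inductive limit. -/
def of (n : ℕ) : MatAlg a n →⋆ₐ[ℂ] UHFAlg a where
  toFun X := ⟦⟨n, X⟩⟧
  map_one' := (DirectLimit.one_def n).symm
  map_mul' X Y := (DirectLimit.mul_def n X Y).symm
  map_zero' := (DirectLimit.zero_def n).symm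
  map_add' X Y := (DirectLimit.add_def n X Y).symm
  commutes' c := (DirectLimit.algebraMap_def n c).symm
  map_star' X := (DirectLimit.star_def n X).symm

theorem of_emb {n m : ℕ} (h : n ≤ m) (X : MatAlg a n) : of a m (MatAlg.emb a h X) = of a n X :=
  DirectLimit.mk_apply n m X h

variable {a}

/-- The universal property of the algebraic inductive limit. -/
def lift {B : Type*} [Ring B] [StarRing B] [Algebra ℂ B] (g : ∀ n, MatAlg a n →⋆ₐ[ℂ] B)
    (hg : ∀ n m (h : n ≤ m) X, g m (MatAlg.emb a h X) = g n X) : UHFAlg a →⋆ₐ[ℂ] B where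
  toFun := DirectLimit.lift _ (fun n X => g n X) (fun n m h X => (hg n m h X).symm)
  map_one' := map_one (g _)
  map_mul' := DirectLimit.induction₂ _ fun n X Y => by
    rw [DirectLimit.mul_def]; exact map_mul (g n) X Y
  map_zero' := map_zero (g _)
  map_add' := DirectLimit.induction₂ _ fun n X Y => by
    rw [DirectLimit.add_def]; exact map_add (g n) X Y
  commutes' c := AlgHomClass.commutes (g _) c
  map_star' := DirectLimit.induction _ fun n X => map_star (g n) X

theorem lift_of {B : Type*} [Ring B] [StarRing B] [Algebra ℂ B] (g : ∀ n, MatAlg a n →⋆ₐ[ℂ] B)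
    (hg : ∀ n m (h : n ≤ m) X, g m (MatAlg.emb a h X) = g n X) (n : ℕ) (X : MatAlg a n) :
    lift g hg (of a n X) = g n X := rfl

end UHFAlg

/-- The UHF algebra of the sequence `a`: the C*-algebraic inductive limit of the matrix algebras
`M_{a₁} ⊗ ⋯ ⊗ M_{aₙ}` with the embeddings `X ↦ X ⊗ I`. -/
def UHF (a : SeqGeTwo) : Type := (UHFAlg.norm a).Compl

instance (a : SeqGeTwo) : CStarAlgebra (UHF a) := inferInstanceAs (CStarAlgebra (UHFAlg.norm a).Compl)

/-- The canonical embedding of `M_{a₁} ⊗ ⋯ ⊗ M_{aₙ}` into the UHF algebra. -/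
def UHF.of (a : SeqGeTwo) (n : ℕ) : MatAlg a n →⋆ₐ[ℂ] UHF a :=
  (UHFAlg.norm a).of.comp (UHFAlg.of a n)

theorem UHF.of_emb (a : SeqGeTwo) {n m : ℕ} (h : n ≤ m) (X : MatAlg a n) :
    UHF.of a m (MatAlg.emb a h X) = UHF.of a n X :=
  congrArg (UHFAlg.norm a).of (UHFAlg.of_emb a h X)

end UHF

/-! ### The isomorphism `φ` of `UHF (a * b)` with the tensor product of `UHF a` and `UHF b` -/

section Phi

open scoped Matrix.Norms.L2Operator Kronecker

/-- The universal property of the inductive limit of C*-algebras. -/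
def UHF.lift {a : SeqGeTwo} {B : Type*} [CStarAlgebra B] (g : ∀ n, MatAlg a n →⋆ₐ[ℂ] B)
    (hg : ∀ n m (h : n ≤ m) X, g m (MatAlg.emb a h X) = g n X) : UHF a →⋆ₐ[ℂ] B :=
  (UHFAlg.norm a).liftUnital (UHFAlg.lift g hg)
    (DirectLimit.induction _ fun n X => NonUnitalStarAlgHom.norm_apply_le (g n) X)

theorem UHF.lift_of {a : SeqGeTwo} {B : Type*} [CStarAlgebra B] (g : ∀ n, MatAlg a n →⋆ₐ[ℂ] B)
    (hg : ∀ n m (h : n ≤ m) X, g m (MatAlg.emb a h X) = g n X) (n : ℕ) (X : MatAlg a n) :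
    UHF.lift g hg (UHF.of a n X) = g n X :=
  (UHFAlg.norm a).liftUnital_of _ _ _

/-- The map `x ⊗ y ↦ f(x) ⊗ g(y)` as a `*`-homomorphism of algebraic tensor products. -/
def starTensorMap {A A' B B' : Type*} [Ring A] [StarRing A] [Algebra ℂ A] [StarModule ℂ A]
    [Ring A'] [StarRing A'] [Algebra ℂ A'] [StarModule ℂ A']
    [Ring B] [StarRing B] [Algebra ℂ B] [StarModule ℂ B]
    [Ring B'] [StarRing B'] [Algebra ℂ B'] [StarModule ℂ B']
    (f : A →⋆ₐ[ℂ] A') (g : B →⋆ₐ[ℂ] B') : A ⊗[ℂ] B →⋆ₐ[ℂ] A' ⊗[ℂ] B' :=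
  { Algebra.TensorProduct.map (f : A →ₐ[ℂ] A') (g : B →ₐ[ℂ] B') with
    map_star' := fun x => by
      change Algebra.TensorProduct.map (f : A →ₐ[ℂ] A') (g : B →ₐ[ℂ] B') (star x) =
        star (Algebra.TensorProduct.map (f : A →ₐ[ℂ] A') (g : B →ₐ[ℂ] B') x)
      induction x with
      | zero => simp
      | add x y hx hy => rw [star_add, map_add, map_add, star_add, hx, hy]
      | tmul x y => simp [TensorProduct.star_tmul, map_star] }

theorem starTensorMap_tmul {A A' B B' : Type*} [Ring A] [StarRing A] [Algebra ℂ A] [StarModule ℂ A]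
    [Ring A'] [StarRing A'] [Algebra ℂ A'] [StarModule ℂ A']
    [Ring B] [StarRing B] [Algebra ℂ B] [StarModule ℂ B]
    [Ring B'] [StarRing B'] [Algebra ℂ B'] [StarModule ℂ B']
    (f : A →⋆ₐ[ℂ] A') (g : B →⋆ₐ[ℂ] B') (x : A) (y : B) :
    starTensorMap f g (x ⊗ₜ y) = f x ⊗ₜ g y := rfl

/-- The bijection `J ↦ (J', J'')` given by `jᵢ = bᵢ * jᵢ' + jᵢ''` (with indices starting at `0`). -/
def MultiIndex.unzip (a b : SeqGeTwo) (n : ℕ) :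
    MultiIndex (a * b) n ≃ MultiIndex a n × MultiIndex b n where
  toFun J := (fun i => (finProdFinEquiv.symm (J i)).1, fun i => (finProdFinEquiv.symm (J i)).2)
  invFun p i := finProdFinEquiv (p.1 i, p.2 i)
  left_inv J := funext fun i => finProdFinEquiv.apply_symm_apply (J i)
  right_inv p := by
    refine Prod.ext (funext fun i => ?_) (funext fun i => ?_)
    · exact congrArg Prod.fst (finProdFinEquiv.symm_apply_apply (p.1 i, p.2 i))
    · exact congrArg Prod.snd (finProdFinEquiv.symm_apply_apply (p.1 i, p.2 i))

theorem MultiIndex.unzip_symm_val (a b : SeqGeTwo) (n : ℕ) (J : MultiIndex a n)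
    (K : MultiIndex b n) (i : Fin n) :
    ((MultiIndex.unzip a b n).symm (J, K) i).val = (b i).val * (J i).val + (K i).val :=
  add_comm _ _

/-- The componentwise inverse of the Kronecker product as a `*`-isomorphism:
`E_{J,K} ↦ E_{J',K'} ⊗ E_{J'',K''}`. -/
def MatAlg.phi (a b : SeqGeTwo) (n : ℕ) :
    MatAlg (a * b) n ≃⋆ₐ[ℂ] MatAlg a n ⊗[ℂ] MatAlg b n :=
  (StarAlgEquiv.ofAlgEquiv (Matrix.reindexAlgEquiv ℂ ℂ (MultiIndex.unzip a b n))
    (fun X => by ext; simp)).trans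
    (Matrix.kroneckerStarAlgEquiv (MultiIndex a n) (MultiIndex b n) ℂ).symm

theorem MatAlg.phi_symm_tmul (a b : SeqGeTwo) (n : ℕ) (X : MatAlg a n) (Y : MatAlg b n)
    (J K : MultiIndex (a * b) n) :
    (MatAlg.phi a b n).symm (X ⊗ₜ Y) J K =
      X (MultiIndex.unzip a b n J).1 (MultiIndex.unzip a b n K).1 *
        Y (MultiIndex.unzip a b n J).2 (MultiIndex.unzip a b n K).2 := by
  change kroneckerLinearEquiv _ _ _ _ ℂ (X ⊗ₜ Y) _ _ = _
  rw [kroneckerLinearEquiv_tmul]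
  rfl

theorem MatAlg.phi_single (a b : SeqGeTwo) (n : ℕ) (J K : MultiIndex (a * b) n) :
    MatAlg.phi a b n (Matrix.single J K 1) =
      Matrix.single (MultiIndex.unzip a b n J).1 (MultiIndex.unzip a b n K).1 1 ⊗ₜ
        Matrix.single (MultiIndex.unzip a b n J).2 (MultiIndex.unzip a b n K).2 1 := by
  refine (congrArg (MatAlg.phi a b n) ?_).trans ((MatAlg.phi a b n).apply_symm_apply _)
  ext L M
  rw [MatAlg.phi_symm_tmul]
  simp only [Matrix.single_apply, ← ite_and, mul_ite, mul_one, mul_zero]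
  refine if_congr ?_ rfl rfl
  rw [← (MultiIndex.unzip a b n).injective.eq_iff, ← (MultiIndex.unzip a b n).injective.eq_iff,
    Prod.ext_iff, Prod.ext_iff]
  tauto

theorem MatAlg.emb_phi_symm (a b : SeqGeTwo) {n m : ℕ} (h : n ≤ m) (X : MatAlg a n)
    (Y : MatAlg b n) :
    MatAlg.emb (a * b) h ((MatAlg.phi a b n).symm (X ⊗ₜ Y)) =
      (MatAlg.phi a b m).symm (MatAlg.emb a h X ⊗ₜ MatAlg.emb b h Y) := by
  ext J K
  rw [MatAlg.emb_apply, MatAlg.phi_symm_tmul, MatAlg.phi_symm_tmul, MatAlg.emb_apply,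
    MatAlg.emb_apply, mul_mul_mul_comm]
  congr 1
  have e (i : Fin m) : J i = K i ↔ (MultiIndex.unzip a b m J).1 i = (MultiIndex.unzip a b m K).1 i ∧
      (MultiIndex.unzip a b m J).2 i = (MultiIndex.unzip a b m K).2 i := by
    refine Iff.trans ?_ Prod.ext_iff
    exact (finProdFinEquiv.symm.injective.eq_iff (a := J i) (b := K i)).symm
  generalize (MultiIndex.unzip a b m J).1 = J₁ at e ⊢
  generalize (MultiIndex.unzip a b m J).2 = J₂ at e ⊢
  generalize (MultiIndex.unzip a b m K).1 = K₁ at e ⊢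
  generalize (MultiIndex.unzip a b m K).2 = K₂ at e ⊢
  have e' : (∀ i : Fin m, n ≤ i.1 → J i = K i) ↔
      (∀ i : Fin m, n ≤ i.1 → J₁ i = K₁ i) ∧ ∀ i : Fin m, n ≤ i.1 → J₂ i = K₂ i :=
    ⟨fun H => ⟨fun i hi => ((e i).1 (H i hi)).1, fun i hi => ((e i).1 (H i hi)).2⟩,
      fun H i hi => (e i).2 ⟨H.1 i hi, H.2 i hi⟩⟩
  by_cases h1 : ∀ i : Fin m, n ≤ i.1 → J₁ i = K₁ i
  · by_cases h2 : ∀ i : Fin m, n ≤ i.1 → J₂ i = K₂ i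
    · rw [if_pos h1, if_pos h2, if_pos (e'.2 ⟨h1, h2⟩), mul_one]
    · rw [if_neg h2, if_neg (fun H => h2 (e'.1 H).2), mul_zero]
  · rw [if_neg h1, if_neg (fun H => h1 (e'.1 H).1), zero_mul]

/-- `φ` on the `n`-th matrix algebra, as a `*`-homomorphism into the tensor product of the UHF
algebras. -/
def UHF.phiAux (a b : SeqGeTwo) (n : ℕ) : MatAlg (a * b) n →⋆ₐ[ℂ] MinTensor (UHF a) (UHF b) :=
  ((MinTensor.of (UHF a) (UHF b)).comp (starTensorMap (UHF.of a n) (UHF.of b n))).comp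
    (MatAlg.phi a b n : MatAlg (a * b) n →⋆ₐ[ℂ] MatAlg a n ⊗[ℂ] MatAlg b n)

theorem UHF.phiAux_symm (a b : SeqGeTwo) (n : ℕ) (t : MatAlg a n ⊗[ℂ] MatAlg b n) :
    UHF.phiAux a b n ((MatAlg.phi a b n).symm t) =
      MinTensor.of (UHF a) (UHF b) (starTensorMap (UHF.of a n) (UHF.of b n) t) :=
  congrArg (fun s => MinTensor.of (UHF a) (UHF b) (starTensorMap (UHF.of a n) (UHF.of b n) s))
    ((MatAlg.phi a b n).apply_symm_apply t)

theorem UHF.phiAux_emb (a b : SeqGeTwo) (n m : ℕ) (h : n ≤ m) (X : MatAlg (a * b) n) :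
    UHF.phiAux a b m (MatAlg.emb (a * b) h X) = UHF.phiAux a b n X := by
  obtain ⟨t, rfl⟩ : ∃ t, (MatAlg.phi a b n).symm t = X :=
    ⟨MatAlg.phi a b n X, (MatAlg.phi a b n).symm_apply_apply X⟩
  induction t with
  | zero => simp only [map_zero]
  | add s t hs ht => simp only [map_add, hs, ht]
  | tmul x y =>
    rw [MatAlg.emb_phi_symm, phiAux_symm, phiAux_symm, starTensorMap_tmul, starTensorMap_tmul,
      UHF.of_emb, UHF.of_emb]

/-- The `*`-isomorphism `φ` of `UHF (a * b)` with the minimal tensor product of `UHF a` and `UHF b`,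
which is `E_{J,K} ↦ E_{J',K'} ⊗ E_{J'',K''}` on each of the matrix algebras. -/
def UHF.phi (a b : SeqGeTwo) : UHF (a * b) →⋆ₐ[ℂ] MinTensor (UHF a) (UHF b) :=
  UHF.lift (UHF.phiAux a b) (UHF.phiAux_emb a b)

theorem UHF.phi_single (a b : SeqGeTwo) (n : ℕ) (J K : MultiIndex (a * b) n) :
    UHF.phi a b (UHF.of (a * b) n (Matrix.single J K 1)) =
      MinTensor.of (UHF a) (UHF b)
        (UHF.of a n (Matrix.single (MultiIndex.unzip a b n J).1 (MultiIndex.unzip a b n K).1 1) ⊗ₜ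
          UHF.of b n (Matrix.single (MultiIndex.unzip a b n J).2
            (MultiIndex.unzip a b n K).2 1)) := by
  rw [UHF.phi, UHF.lift_of]
  exact congrArg (fun s => MinTensor.of (UHF a) (UHF b)
    (starTensorMap (UHF.of a n) (UHF.of b n) s)) (MatAlg.phi_single a b n J K)

end Phi

/-! ### The tensor product `⊗_φ` -/

/-- The tensor product `ω ⊗_φ ω' = (ω ⊗ ω') ∘ φ` of states. -/
def CStarState.tensorPhi {a b : SeqGeTwo} (ω : CStarState (UHF a)) (ω' : CStarState (UHF b)) :
    CStarState (UHF (a * b)) :=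
  (ω.tensor ω').comp (UHF.phi a b)

/-- The tensor product `π ⊗_φ π' = (π ⊗ π') ∘ φ` of representations. -/
def StarRep.tensorPhi {a b : SeqGeTwo} (π : StarRep (UHF a)) (π' : StarRep (UHF b)) :
    StarRep (UHF (a * b)) :=
  (π.tensor π').comp (UHF.phi a b)

/-- The tensor product `[π] ⊗_φ [π'] = [π ⊗_φ π']` of unitary equivalence classes. -/
def RepClass.tensorPhi {a b : SeqGeTwo} (x : RepClass (UHF a)) (y : RepClass (UHF b)) :
    RepClass (UHF (a * b)) :=
  (x.tensor y).comp (UHF.phi a b)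

theorem RepClass.tensorPhi_cls {a b : SeqGeTwo} (π : StarRep (UHF a)) (π' : StarRep (UHF b)) :
    RepClass.tensorPhi π.cls π'.cls = (π.tensorPhi π').cls := rfl

/-! ### The classes `P_n[J]` -/

section PureProductStates

open scoped Matrix.Norms.L2Operator ComplexOrder

variable {a : SeqGeTwo}

/-- The first `n` components of an infinite index sequence. -/
def seqRes (J : ∀ i, Fin (a i).val) (n : ℕ) : MultiIndex a n := fun i => J i

theorem Matrix.norm_diag_entry_le {ι : Type*} [Fintype ι] [DecidableEq ι] (X : Matrix ι ι ℂ) (i : ι) :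
    ‖X i i‖ ≤ ‖X‖ := by
  have h := Matrix.l2_opNorm_mulVec X (EuclideanSpace.single i 1)
  rw [PiLp.norm_single, norm_one, mul_one] at h
  refine le_trans ?_ h
  refine le_trans (le_of_eq ?_) (PiLp.norm_apply_le _ i)
  simp

/-- The functional `X ↦ X_{J,J}` on the algebraic inductive limit. -/
def UHFAlg.diag (J : ∀ i, Fin (a i).val) : UHFAlg a →ₗ[ℂ] ℂ :=
  DirectLimit.Module.lift ℂ ℕ (MatAlg a) (fun _ _ h => MatAlg.emb a h)
    (fun n => Matrix.entryLinearMap ℂ ℂ (seqRes J n) (seqRes J n))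
    (fun n m h X => by
      simp only [Matrix.entryLinearMap_apply, MatAlg.emb_apply]
      rw [if_pos (fun _ _ => trivial), mul_one]
      rfl)

theorem UHFAlg.norm_diag_le (J : ∀ i, Fin (a i).val) :
    ∀ x, ‖UHFAlg.diag J x‖ ≤ (UHFAlg.norm a).p x :=
  DirectLimit.induction _ fun _ X => Matrix.norm_diag_entry_le X _

theorem UHFAlg.diag_nonneg (J : ∀ i, Fin (a i).val) (x : (UHFAlg.norm a).Compl) :
    0 ≤ (UHFAlg.norm a).liftL (UHFAlg.diag J) (UHFAlg.norm_diag_le J) (star x * x) := by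
  induction x using (UHFAlg.norm a).of_dense.induction_on with
  | hp =>
    exact isClosed_Ici.preimage (((UHFAlg.norm a).liftL _ (UHFAlg.norm_diag_le J)).continuous.comp
      ((UHFAlg.norm a).continuous_star.mul continuous_id))
  | ih x =>
    rw [← map_star, ← map_mul, CStarSeminorm.liftL_of]
    induction x using DirectLimit.induction with
    | ih n X =>
      rw [DirectLimit.star_def, DirectLimit.mul_def]
      change 0 ≤ (star X * X) (seqRes J n) (seqRes J n)
      rw [Matrix.mul_apply]
      exact Finset.sum_nonneg fun K _ => star_mul_self_nonneg (X K (seqRes J n))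

theorem UHFAlg.diag_one (J : ∀ i, Fin (a i).val) :
    (UHFAlg.norm a).liftL (UHFAlg.diag J) (UHFAlg.norm_diag_le J) 1 = 1 := by
  rw [← map_one (UHFAlg.norm a).of, CStarSeminorm.liftL_of, ← map_one (UHFAlg.of a 0)]
  exact Matrix.one_apply_eq _

/-- The product state `ω` of the vector states of the basis vectors with numbers `j₁, j₂, …`, that
is, `ω (E_{l₁,k₁} ⊗ ⋯ ⊗ E_{lₙ,kₙ}) = ∏ᵢ δ_{lᵢ,jᵢ} δ_{kᵢ,jᵢ}`. -/
def UHF.productState (J : ∀ i, Fin (a i).val) : CStarState (UHF a) where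
  toLin := ((UHFAlg.norm a).liftL (UHFAlg.diag J) (UHFAlg.norm_diag_le J)).toLinearMap
  nonneg := UHFAlg.diag_nonneg J
  map_one := UHFAlg.diag_one J

theorem UHF.productState_of (J : ∀ i, Fin (a i).val) (n : ℕ) (X : MatAlg a n) :
    (UHF.productState J).toLin (UHF.of a n X) = X (seqRes J n) (seqRes J n) :=
  (UHFAlg.norm a).liftL_of _ (UHFAlg.norm_diag_le J) _

end PureProductStates

/-- The constant sequence `(n, n, n, …)`. -/
def constSeq (n : ℕ) (h : 2 ≤ n := by norm_num) : SeqGeTwo := fun _ => ⟨n, h⟩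

theorem constSeq_two_mul_two : constSeq 2 * constSeq 2 = constSeq 4 := rfl

/-- `P_n[J]`: the unitary equivalence class of the GNS representation of the product state given by
`J`. All indices start at `0`. -/
def classP (n : ℕ) (J : ℕ → Fin n) (h : 2 ≤ n := by norm_num) : RepClass (UHF (constSeq n h)) :=
  (UHF.productState (a := constSeq n h) J).gns.cls

/-- A state of `UHF a` as a state of the same algebra `UHF b`, for equal sequences `a` and `b`. -/
def CStarState.cast {a b : SeqGeTwo} (h : a = b) (ω : CStarState (UHF a)) : CStarState (UHF b) :=
  h ▸ ω

/-- A class of representations of `UHF a` as a class of representations of the same algebra `UHF b`,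
for equal sequences `a` and `b`. -/
def RepClass.cast {a b : SeqGeTwo} (h : a = b) (x : RepClass (UHF a)) : RepClass (UHF b) :=
  h ▸ x

end

/-! On pure product states `⊗_φ` is interleaving of index sequences: with indices starting at `0`,
the states of `J` and `K` give the state of the sequence with entries `bᵢ * Jᵢ + Kᵢ`. This pairing
of digits is not symmetric. For `a = b = (2, 2, …)` the digits `(0, 1)` give `1`, whereas `(1, 0)`
give `2`. Everything else transports this observation from states to unitary equivalence classes.

Two facts are needed. First, the GNS construction is compatible with `⊗_φ`
(`CStarState.gns_tensorPhi`): the tensor product of the two GNS vectors is cyclic for the tensor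
product representation and its vector state is `ω ⊗_φ ω'`, so uniqueness of cyclic representations
with a given vector state (`StarRep.equivalent_of_cyclic`) applies. Together with
`UHF.productState_tensorPhi` this computes both products of classes.

Second, the resulting classes are different, which is stronger than the states being different. If
`J` and `K` differ infinitely often (`UHF.gns_productState_ne`), consider the projections `pₙ` onto
the first `n` digits of `K`. They fix the GNS vector of `K`, but in the GNS representation of `J`
they tend strongly to `0`, since a local operator changes only finitely many digits of `J`. A
unitary equivalence would produce a vector on which all `pₙ` have norm `1`, which is impossible. -/

/-! ### Cyclic vectors and the uniqueness of the GNS representation -/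

section Cyclic

variable {A B : Type} [CStarAlgebra A] [CStarAlgebra B]

/-- The map `a ↦ π(a) Ω`. -/
noncomputable def StarRep.orbit (π : StarRep A) (Ω : π.H) : A →ₗ[ℂ] π.H where
  toFun a := π.π a Ω
  map_add' a b := by rw [map_add, add_apply]
  map_smul' c a := by rw [map_smul, smul_apply]; rfl

theorem StarRep.orbit_apply (π : StarRep A) (Ω : π.H) (a : A) : π.orbit Ω a = π.π a Ω := rfl

theorem StarRep.continuous_π (π : StarRep A) : Continuous π.π :=
  AddMonoidHomClass.continuous_of_bound π.π 1 fun x => by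
    rw [one_mul]; exact π.norm_le x

theorem StarRep.continuous_orbit (π : StarRep A) (Ω : π.H) : Continuous (π.orbit Ω) :=
  π.continuous_π.clm_apply continuous_const

theorem StarRep.inner_apply_apply (π : StarRep A) (Ω : π.H) (a b : A) :
    ⟪π.π a Ω, π.π b Ω⟫_ℂ = ⟪Ω, π.π (star a * b) Ω⟫_ℂ := by
  rw [map_mul, map_star, mul_apply_eq_comp, ContinuousLinearMap.star_eq_adjoint,
    ContinuousLinearMap.adjoint_inner_right]

/-- Cyclic representations with the same vector state are unitarily equivalent. -/
theorem StarRep.equivalent_of_cyclic {π σ : StarRep A} {Ω : π.H} {Ω' : σ.H}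
    (hΩ : DenseRange (π.orbit Ω)) (hΩ' : DenseRange (σ.orbit Ω'))
    (h : ∀ a, ⟪Ω, π.π a Ω⟫_ℂ = ⟪Ω', σ.π a Ω'⟫_ℂ) : π.Equivalent σ := by
  -- The squared norm of `π(a) Ω` is the vector state at `a* a`, so the two orbit maps have equal
  -- norms and `π(a) Ω ↦ σ(a) Ω'` is a well-defined isometry between dense subspaces. Both orbits
  -- are parametrized by `A` itself, hence the identity equivalence.
  have hn (a : A) : ‖σ.orbit Ω' (LinearEquiv.refl ℂ A a)‖ = ‖π.orbit Ω a‖ := by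
    rw [LinearEquiv.refl_apply, ← sq_eq_sq₀ (norm_nonneg _) (norm_nonneg _),
      ← inner_self_eq_norm_sq (𝕜 := ℂ), ← inner_self_eq_norm_sq (𝕜 := ℂ), orbit_apply, orbit_apply,
      inner_apply_apply, inner_apply_apply, h]
  let U := (LinearEquiv.refl ℂ A).extendOfIsometry (π.orbit Ω) (σ.orbit Ω') hΩ hΩ' hn
  have hU (a : A) : U (π.π a Ω) = σ.π a Ω' :=
    LinearEquiv.extendOfIsometry_eq _ _ _ hΩ hΩ' hn a
  refine ⟨U, fun a x => ?_⟩
  -- On an orbit vector both sides of the intertwining relation equal `σ(ab) Ω'`; density does the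
  -- rest.
  induction x using hΩ.induction_on with
  | hp =>
    exact isClosed_eq (U.continuous.comp (π.π a).continuous) ((σ.π a).continuous.comp U.continuous)
  | ih b =>
    rw [orbit_apply, hU, ← mul_apply_eq_comp, ← mul_apply_eq_comp, ← map_mul, ← map_mul, hU]

/-- The GNS vector is the class of `1`, so its orbit is the image of `A` in the completion that
defines the GNS space. -/
theorem CStarState.denseRange_orbit_gnsVec (ω : CStarState A) :
    DenseRange (ω.gns.orbit ω.gnsVec) := by
  let _ := CStarAlgebra.spectralOrder A
  have _ := CStarAlgebra.spectralOrderedRing A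
  have h (a : A) : ω.gns.orbit ω.gnsVec a = ((ω.toPositive.toPreGNS a : ω.toPositive.PreGNS) :
      ω.toPositive.GNS) := by
    refine (PositiveLinearMap.gnsNonUnitalStarAlgHom_apply_coe ω.toPositive).trans ?_
    simp
  have e : ⇑(ω.gns.orbit ω.gnsVec) = fun a => ((ω.toPositive.toPreGNS a : ω.toPositive.PreGNS) :
      ω.toPositive.GNS) := funext h
  rw [e]
  exact UniformSpace.Completion.denseRange_coe.comp ω.toPositive.toPreGNS.surjective.denseRange
    (UniformSpace.Completion.continuous_coe _)

/-- Continuity is not part of the definition of a state; it follows from writing the state as a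
vector state of its GNS representation. -/
theorem CStarState.continuous_toLin (ω : CStarState A) : Continuous ω.toLin := by
  have e : ⇑ω.toLin = fun a => ⟪ω.gnsVec, ω.gns.orbit ω.gnsVec a⟫_ℂ :=
    funext fun a => (ω.inner_gnsVec a).symm
  rw [e]
  exact continuous_const.inner (ω.gns.continuous_orbit _)

end Cyclic

/-! ### Reduction to the dense union of the matrix algebras -/

section UHFDensity

/-- Density induction in a UHF algebra. -/
theorem UHF.induction {a : SeqGeTwo} {P : UHF a → Prop} (hc : IsClosed {x | P x})
    (h : ∀ n X, P (UHF.of a n X)) (x : UHF a) : P x :=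
  (UHFAlg.norm a).of_dense.induction_on x hc (DirectLimit.induction _ h)

theorem UHF.state_ext {a : SeqGeTwo} {ω ω' : CStarState (UHF a)}
    (h : ∀ n X, ω.toLin (UHF.of a n X) = ω'.toLin (UHF.of a n X)) : ω = ω' :=
  CStarState.ext fun x => by
    induction x using UHF.induction with
    | hc => exact isClosed_eq ω.continuous_toLin ω'.continuous_toLin
    | h n X => exact h n X

/-- Density induction in a cyclic representation of a UHF algebra. -/
theorem UHF.cyclic_induction {a : SeqGeTwo} {π : StarRep (UHF a)} {Ω : π.H}
    (hΩ : DenseRange (π.orbit Ω)) {P : π.H → Prop} (hc : IsClosed {x | P x})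
    (h : ∀ n X, P (π.π (UHF.of a n X) Ω)) (x : π.H) : P x := by
  induction x using hΩ.induction_on with
  | hp => exact hc
  | ih c =>
    induction c using UHF.induction with
    | hc => exact hc.preimage (π.continuous_orbit Ω)
    | h n X => exact h n X

end UHFDensity

/-! ### `⊗_φ` of GNS representations -/

section TensorPhi

variable {a b : SeqGeTwo}

/-- This form of `φ` allows arguments by induction on elementary tensors in place of expansions in
matrix units. -/
theorem UHF.phi_of_symm_tmul (n : ℕ) (X : MatAlg a n) (Y : MatAlg b n) :
    UHF.phi a b (UHF.of (a * b) n ((MatAlg.phi a b n).symm (X ⊗ₜ Y))) =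
      MinTensor.of (UHF a) (UHF b) (UHF.of a n X ⊗ₜ UHF.of b n Y) := by
  rw [UHF.phi, UHF.lift_of, UHF.phiAux_symm, starTensorMap_tmul]

/-- Separate continuity is enough below, where closures are taken in one tensor factor at a time. -/
theorem continuous_htmul_left {H K : Type} [NormedAddCommGroup H] [InnerProductSpace ℂ H]
    [NormedAddCommGroup K] [InnerProductSpace ℂ K] (y : K) :
    Continuous fun x : H => htmul x y := by
  let f : H →ₗ[ℂ] HilbertTensor H K :=
    (HilbertTensor.of H K).toLinearMap ∘ₗ (TensorProduct.mk ℂ H K).flip y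
  refine AddMonoidHomClass.continuous_of_bound f ‖y‖ fun x => le_of_eq ?_
  change ‖HilbertTensor.of H K (x ⊗ₜ y)‖ = _
  rw [LinearIsometry.norm_map, TensorProduct.norm_tmul, mul_comm]

theorem continuous_htmul_right {H K : Type} [NormedAddCommGroup H] [InnerProductSpace ℂ H]
    [NormedAddCommGroup K] [InnerProductSpace ℂ K] (x : H) :
    Continuous fun y : K => htmul x y := by
  let f : K →ₗ[ℂ] HilbertTensor H K :=
    (HilbertTensor.of H K).toLinearMap ∘ₗ TensorProduct.mk ℂ H K x
  refine AddMonoidHomClass.continuous_of_bound f ‖x‖ fun y => le_of_eq ?_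
  change ‖HilbertTensor.of H K (x ⊗ₜ y)‖ = _
  rw [LinearIsometry.norm_map, TensorProduct.norm_tmul]

/-- Surjectivity of `φ` is not needed: its range contains all `X ⊗ Y` with `X` and `Y` from matrix
algebras of the same level, and these already move `Ω ⊗ Ω'` to a total set. -/
theorem StarRep.denseRange_orbit_tensorPhi {π : StarRep (UHF a)} {σ : StarRep (UHF b)}
    {Ω : π.H} {Ω' : σ.H} (hΩ : DenseRange (π.orbit Ω)) (hΩ' : DenseRange (σ.orbit Ω')) :
    DenseRange ((π.tensorPhi σ).orbit (htmul Ω Ω' : HilbertTensor π.H σ.H)) := by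
  let Ω'' : (π.tensorPhi σ).H := (htmul Ω Ω' : HilbertTensor π.H σ.H)
  -- The closure is taken as a subspace, so that sums of elementary tensors stay inside. `S` is the
  -- same set, seen in the Hilbert tensor product that underlies the representation.
  let M : Submodule ℂ (π.tensorPhi σ).H :=
    (LinearMap.range ((π.tensorPhi σ).orbit Ω'')).topologicalClosure
  let S : Set (HilbertTensor π.H σ.H) := (M : Set (π.tensorPhi σ).H)
  have hM : IsClosed (M : Set (π.tensorPhi σ).H) := Submodule.isClosed_topologicalClosure _
  have hS : IsClosed S := hM
  have h0 (n : ℕ) (X : MatAlg a n) (Y : MatAlg b n) :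
      htmul (π.π (UHF.of a n X) Ω) (σ.π (UHF.of b n Y) Ω') ∈ S := by
    let t := UHF.of (a * b) n ((MatAlg.phi a b n).symm (X ⊗ₜ Y))
    have ht : (π.tensorPhi σ).orbit Ω'' t ∈ M :=
      Submodule.le_topologicalClosure _ ⟨t, rfl⟩
    have e : π.tensorHom σ (UHF.phi a b t) (htmul Ω Ω') =
        htmul (π.π (UHF.of a n X) Ω) (σ.π (UHF.of b n Y) Ω') := by
      rw [UHF.phi_of_symm_tmul, tensorHom_tmul, opTensor_htmul]
    rw [← e]
    exact ht
  have h1 (x : π.H) (y : σ.H) : htmul x y ∈ S := by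
    induction x using UHF.cyclic_induction hΩ with
    | hc => exact hS.preimage (continuous_htmul_left y)
    | h n X =>
      induction y using UHF.cyclic_induction hΩ' with
      | hc => exact hS.preimage (continuous_htmul_right _)
      | h m Y =>
        -- `φ` pairs matrix algebras of equal level, so both factors are first moved to level `max n
        -- m`.
        rw [← UHF.of_emb a (le_max_left n m) X, ← UHF.of_emb b (le_max_right n m) Y]
        exact h0 _ _ _
  intro z
  change z ∈ S
  induction z using HilbertTensor.of_dense.induction_on with
  | hp => exact hS
  | ih t =>
    induction t with
    | zero => rw [map_zero]; exact M.zero_mem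
    | add s t hs ht => rw [map_add]; exact M.add_mem hs ht
    | tmul x y => exact h1 x y

/-- Both representations are cyclic with the same vector state; the agreement of the states is
definitional, because `ω ⊗ ω'` was defined as the vector state of the tensor product of the GNS
vectors. -/
theorem CStarState.gns_tensorPhi (ω : CStarState (UHF a)) (ω' : CStarState (UHF b)) :
    RepClass.tensorPhi ω.gns.cls ω'.gns.cls = (ω.tensorPhi ω').gns.cls := by
  rw [RepClass.tensorPhi_cls]
  refine Quotient.sound (StarRep.equivalent_of_cyclic
    (StarRep.denseRange_orbit_tensorPhi ω.denseRange_orbit_gnsVec ω'.denseRange_orbit_gnsVec)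
    (ω.tensorPhi ω').denseRange_orbit_gnsVec fun x => ?_)
  rw [inner_gnsVec]
  rfl

end TensorPhi

/-! ### Pure product states -/

section ProductStates

variable {a b : SeqGeTwo}

/-- A product state reads off one diagonal entry, and the diagonal entry of a Kronecker product at
an interleaved index is the product of the diagonal entries of the factors. -/
theorem UHF.productState_tensorPhi (J : ∀ i, Fin (a i).val) (K : ∀ i, Fin (b i).val) :
    (UHF.productState J).tensorPhi (UHF.productState K) =
      UHF.productState (a := a * b) fun i => finProdFinEquiv (J i, K i) := by
  refine UHF.state_ext fun n X => ?_
  obtain ⟨t, rfl⟩ : ∃ t, (MatAlg.phi a b n).symm t = X :=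
    ⟨MatAlg.phi a b n X, (MatAlg.phi a b n).symm_apply_apply X⟩
  induction t with
  | zero => simp only [map_zero]
  | add s t hs ht => simp only [map_add, hs, ht]
  | tmul X Y =>
    have e : MultiIndex.unzip a b n
        (seqRes (a := a * b) (fun i => finProdFinEquiv (J i, K i)) n) = (seqRes J n, seqRes K n) :=
      (MultiIndex.unzip a b n).apply_symm_apply (seqRes J n, seqRes K n)
    rw [UHF.productState_of, MatAlg.phi_symm_tmul, e]
    change (CStarState.tensor _ _).toLin (UHF.phi a b _) = _
    rw [UHF.phi_of_symm_tmul, CStarState.tensor_tmul, UHF.productState_of, UHF.productState_of]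

theorem UHF.cast_productState (h : a = b) (J : ∀ i, Fin (a i).val) :
    (UHF.productState J).cast h =
      UHF.productState fun i => (J i).cast (congrArg NGeTwo.val (congrFun h i)) := by
  subst h
  rfl

theorem RepClass.cast_gns (h : a = b) (ω : CStarState (UHF a)) :
    RepClass.cast h ω.gns.cls = (ω.cast h).gns.cls := by
  subst h
  rfl

theorem UHF.productState_of_single (J : ∀ i, Fin (a i).val) (n : ℕ) (K : MultiIndex a n) :
    (UHF.productState J).toLin (UHF.of a n (Matrix.single K K 1)) =
      if K = seqRes J n then 1 else 0 := by
  rw [UHF.productState_of, Matrix.single_apply]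
  exact if_congr (and_self_iff) rfl rfl

theorem UHF.productState_injective :
    Function.Injective (UHF.productState : (∀ i, Fin (a i).val) → CStarState (UHF a)) := by
  intro J K h
  funext i
  -- Length `i + 1` is the shortest that sees component `i`. The projection onto the first digits of
  -- `J` has value `1` in the state of `J`, hence also in that of `K`, which forces the digits to
  -- agree.
  have e := UHF.productState_of_single K (i + 1) (seqRes J (i + 1))
  rw [← h, UHF.productState_of_single, if_pos rfl] at e
  by_contra hne
  refine one_ne_zero (e.trans (if_neg fun hJ => hne ?_))
  exact congrFun hJ ⟨i, i.lt_succ_self⟩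

/-- The GNS representations of the pure product states of two sequences which differ infinitely
often are not equivalent. -/
theorem UHF.gns_productState_ne {J K : ∀ i, Fin (a i).val} (hJK : ∀ n, ∃ i, n ≤ i ∧ J i ≠ K i) :
    (UHF.productState J).gns.cls ≠ (UHF.productState K).gns.cls := by
  intro h
  let ω := UHF.productState J
  let ω' := UHF.productState K
  obtain ⟨U, hU⟩ : ω'.gns.Equivalent ω.gns := Quotient.exact h.symm
  let p (n : ℕ) : UHF a := UHF.of a n (Matrix.single (seqRes K n) (seqRes K n) 1)
  have hp (n : ℕ) : star (p n) * p n = p n := by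
    rw [← map_star, ← map_mul]
    congr 1
    simp [Matrix.star_eq_conjTranspose]
  -- The transported GNS vector of `K` keeps norm `1` under every `p n`, as `p n` has expectation
  -- `1` in the state of `K`.
  let v : ω.gns.H := U ω'.gnsVec
  have hv (n : ℕ) : ‖ω.gns.π (p n) v‖ = 1 := by
    rw [← hU, U.norm_map, ← sq_eq_sq₀ (norm_nonneg _) zero_le_one,
      ← inner_self_eq_norm_sq (𝕜 := ℂ), StarRep.inner_apply_apply, hp, CStarState.inner_gnsVec,
      UHF.productState_of_single, if_pos rfl, RCLike.one_re, one_pow]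
  have hle (n : ℕ) (w : ω.gns.H) : ‖ω.gns.π (p n) w‖ ≤ ‖w‖ := by
    refine ((ω.gns.π (p n)).le_opNorm w).trans (mul_le_of_le_one_left (norm_nonneg _) ?_)
    refine (ω.gns.norm_le _).trans ?_
    have h1 := CStarRing.norm_star_mul_self (x := p n)
    rw [hp] at h1
    -- The C*-identity gives `‖p‖ = ‖p‖ * ‖p‖`, hence `‖p‖ ≤ 1`.
    nlinarith [norm_nonneg (p n)]
  -- It suffices to bound the distance from `v` to the dense set of local orbit vectors; the choice
  -- `w = v` is then absurd.
  have key (w : ω.gns.H) : 1 ≤ ‖v - w‖ := by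
    induction w using UHF.cyclic_induction ω.denseRange_orbit_gnsVec with
    | hc => exact isClosed_le continuous_const (continuous_const.sub continuous_id).norm
    | h m X =>
      obtain ⟨i, hi, hne⟩ := hJK m
      have hm : m ≤ i + 1 := hi.trans i.le_succ
      -- The squared norm is the `J`-diagonal entry of `X* p X` at level `i + 1`. Only the entry of
      -- `X ⊗ I` at row `K`, column `J` could contribute, and it vanishes because `I` acts on
      -- component `i ≥ m`, where `J` and `K` differ.
      have h0 : ω.gns.π (p (i + 1)) (ω.gns.π (UHF.of a m X) ω.gnsVec) = 0 := by
        rw [← mul_apply_eq_comp, ← map_mul, ← inner_self_eq_zero (𝕜 := ℂ),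
          StarRep.inner_apply_apply, CStarState.inner_gnsVec, star_mul, mul_assoc,
          ← mul_assoc (star (p (i + 1))), hp, ← UHF.of_emb a hm X, ← map_star, ← map_mul,
          ← map_mul, UHF.productState_of, Matrix.mul_apply]
        refine Finset.sum_eq_zero fun L _ => mul_eq_zero_of_right _ ?_
        rw [Matrix.mul_apply]
        refine Finset.sum_eq_zero fun L' _ => ?_
        rw [Matrix.single_apply]
        split_ifs with hL
        · rw [← hL.2, MatAlg.emb_apply, if_neg, mul_zero, mul_zero]
          exact fun hs => hne (hs ⟨i, i.lt_succ_self⟩ hi).symm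
        · rw [zero_mul]
      have h1 := hle (i + 1) (v - ω.gns.π (UHF.of a m X) ω.gnsVec)
      rwa [map_sub, h0, sub_zero, hv] at h1
  have := key v
  rw [sub_self, norm_zero] at this
  exact absurd this (by norm_num)

end ProductStates

/-! ### The classes `P_n[j]` and the example `2 * 2 = 4` -/

theorem classP_ne {n : ℕ} (h : 2 ≤ n) {j k : Fin n} (hjk : j ≠ k) :
    classP n (fun _ => j) h ≠ classP n (fun _ => k) h :=
  UHF.gns_productState_ne (a := constSeq n h) fun m => ⟨m, le_rfl, hjk⟩

theorem cast_tensorPhi_classP_two (J K : ℕ → Fin 2) :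
    ((classP 2 J).tensorPhi (classP 2 K)).cast constSeq_two_mul_two =
      classP 4 fun i => finProdFinEquiv (J i, K i) := by
  have e := UHF.productState_tensorPhi (a := constSeq 2) (b := constSeq 2) J K
  rw [classP, classP, CStarState.gns_tensorPhi, e, RepClass.cast_gns, UHF.cast_productState]
  rfl

/-- The digit is `2 * 0 + 1 = 1`; with indices starting at `1`, this is `P_2[1] ⊗_φ P_2[2] =
P_4[2]`. -/
theorem cast_tensorPhi_classP_zero_one :
    ((classP 2 fun _ => 0).tensorPhi (classP 2 fun _ => 1)).cast constSeq_two_mul_two =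
      classP 4 fun _ => 1 :=
  cast_tensorPhi_classP_two _ _

/-- The digit is `2 * 1 + 0 = 2`, that is, `P_4[3]` with indices starting at `1`. -/
theorem cast_tensorPhi_classP_one_zero :
    ((classP 2 fun _ => 1).tensorPhi (classP 2 fun _ => 0)).cast constSeq_two_mul_two =
      classP 4 fun _ => 2 :=
  cast_tensorPhi_classP_two _ _

theorem mainTheorem6 :
    (∃ (a b : SeqGeTwo) (ω : CStarState (UHF a)) (ω' : CStarState (UHF b)),
      ω.tensorPhi ω' ≠ (ω'.tensorPhi ω).cast (mul_comm b a)) ∧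
    (∃ (a b : SeqGeTwo) (x : RepClass (UHF a)) (y : RepClass (UHF b)),
      x.tensorPhi y ≠ (y.tensorPhi x).cast (mul_comm b a)) ∧
    (((classP 2 fun _ => 0).tensorPhi (classP 2 fun _ => 1)).cast constSeq_two_mul_two =
        classP 4 fun _ => 1) ∧
    ((classP 4 fun _ => 1) ≠ classP 4 fun _ => 2) ∧
    ((classP 4 fun _ => 2) =
      ((classP 2 fun _ => 1).tensorPhi (classP 2 fun _ => 0)).cast constSeq_two_mul_two) := by
  have hne : (classP 4 fun _ => 1) ≠ classP 4 fun _ => 2 := classP_ne (by norm_num) (by decide)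
  refine ⟨⟨constSeq 2, constSeq 2, UHF.productState fun _ => (0 : Fin 2),
    UHF.productState fun _ => (1 : Fin 2), ?_⟩,
    ⟨constSeq 2, constSeq 2, classP 2 fun _ => 0, classP 2 fun _ => 1, fun h => hne ?_⟩,
    cast_tensorPhi_classP_zero_one, hne, cast_tensorPhi_classP_one_zero.symm⟩
  · have e (J K : ℕ → Fin 2) := UHF.productState_tensorPhi (a := constSeq 2) (b := constSeq 2) J K
    rw [e, e, UHF.cast_productState]
    -- For states a single differing digit suffices: component `0` is `1` on one side and `2` on the
    -- other.
    refine fun h => absurd (congrFun (UHF.productState_injective h) 0) ?_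
    change ¬ (finProdFinEquiv ((0 : Fin 2), (1 : Fin 2)) : Fin (2 * 2)) =
      finProdFinEquiv ((1 : Fin 2), (0 : Fin 2))
    decide
  · rw [← cast_tensorPhi_classP_zero_one, ← cast_tensorPhi_classP_one_zero]
    -- Both sequences are the same here, so the cast along `mul_comm` in `h` is definitionally the
    -- identity.
    exact congrArg (RepClass.cast constSeq_two_mul_two) h
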